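/- For $n\ge 0$ let $C_n=\{\pm1\}^n\rtimes\mathfrak S_n$ be the group of signed permutations of $n$ coordinates (for $n\ge 1$, the symmetry group of the $n$-dimensional hypercube), where $\mathfrak S_n$ acts on $\{\pm1\}^n$ by permuting coordinates. Then $|C_n|=2^n\,n!$. Let $\mathcal H(C_n)=|\mathrm{End}(C_n)|$ be the number of group homomorphisms $C_n\to C_n$, and let $X_n=|\varphi(C_n)|$ be the order of the image of an endomorphism $\varphi$ drawn uniformly at random from $\mathrm{End}(C_n)$. As $n\to\infty$, a random endomorphism of $C_n$ asymptotically almost surely has large image, and hence small kernel: (a) $\displaystyle\lim_{n\to\infty}\mathbb P\big[\,n!\le X_n\le 2^n\,n!\,\big]=1$; (b) $\mathcal H(C_n)\sim 2^{n+2}\,n!$, i.e. $\displaystyle\lim_{n\to\infty}\frac{\mathcal H(C_n)}{2^{n+2}\,n!}=1$. -/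

import Mathlib

open Filter Topology Asymptotics
open scoped Nat

/-- The group `C_n = N ⋊ S_n` of signed permutations (the symmetry group of the `n`-cube):
`N = {±1}^n` is the group of coordinate inversions, and `S_n` permutes the coordinates, acting
on `N` by `(σ • ε) i = ε (σ⁻¹ i)`. The pair `(ε, σ)` acts on `ℝ^n` by
`e_i ↦ ε (σ i) e_{σ i}`. -/
abbrev SignedPerm (n : ℕ) : Type :=
  (Fin n → ℤˣ) ⋊[mulAutArrow] Equiv.Perm (Fin n)

instance SignedPerm.instFinite (n : ℕ) : Finite (SignedPerm n) :=
  Finite.of_equiv _ SemidirectProduct.equivProd.symm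

instance SignedPerm.instFiniteEnd (n : ℕ) : Finite (Monoid.End (SignedPerm n)) :=
  Finite.of_injective (fun f : Monoid.End (SignedPerm n) => (f : SignedPerm n → SignedPerm n))
    DFunLike.coe_injective

noncomputable instance SignedPerm.instFintypeEnd (n : ℕ) : Fintype (Monoid.End (SignedPerm n)) :=
  Fintype.ofFinite _

/-- The number of endomorphisms of `C_n`. -/
noncomputable def numEnd (n : ℕ) : ℕ := Nat.card (Monoid.End (SignedPerm n))

/-- The order of the image of an endomorphism of `C_n`. -/
noncomputable def imageOrder (n : ℕ) (f : Monoid.End (SignedPerm n)) : ℕ :=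
  Nat.card (MonoidHom.range f)

/-- The law of `X_n`, the order of the image of an endomorphism drawn uniformly at random from
`End(C_n)`. -/
noncomputable def imageOrderLaw (n : ℕ) : PMF ℕ :=
  (PMF.uniformOfFintype (Monoid.End (SignedPerm n))).map (imageOrder n)

/-!
Let `W = M ≀ S_n`, with `M` finite abelian (`M = {±1}` gives `C_n`). An endomorphism of `W` induces
an endomorphism of `S_n`, by inclusion and projection. For `n ≥ 5` either the latter is injective or
the former kills `A_n`, since `A_n` is simple and `M^n` is abelian.

If the induced endomorphism is injective, the image has order at least `n!`. For `n ≥ 7` every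
injective endomorphism of `S_n` is inner: it preserves transpositions, because a product of two
transpositions has order dividing `6`, whereas any other involution, acting as a reflection of a
pentagon or an octagon, has a conjugate whose product with it rotates that polygon. So, up to
conjugation by `S_n`, these endomorphisms of `W` lie over `S_n`, and they are pairs of an
equivariant endomorphism of `M^n` (two endomorphisms of `M`, by double transitivity) and a crossed
homomorphism `S_n → M^n` (counted by Shapiro's lemma). For `M = {±1}` there are `2^(n+2) n!` of
them.

If `A_n` is killed, the whole endomorphism factors through `W → M × {±1}`. A homomorphism from a
group `V` of order `m` to `W` is given by an action of `V` on `n` points and a bounded amount of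
data at each point. Such an action has at least `n / m` orbits, and choosing an orbit representative
for each of the other points costs at most `2^n n^((1 - 1/m) n)`, so there are `o(n!)` such
endomorphisms.
-/

section Finiteness

instance finite_semidirectProduct {N G : Type*} [Group N] [Group G] [Finite N] [Finite G]
    (ρ : G →* MulAut N) : Finite (N ⋊[ρ] G) :=
  .of_equiv _ SemidirectProduct.equivProd.symm

instance finite_monoidHom {G H : Type*} [MulOneClass G] [MulOneClass H] [Finite G] [Finite H] :
    Finite (G →* H) :=
  .of_injective _ DFunLike.coe_injective

instance finite_monoidEnd {G : Type*} [MulOneClass G] [Finite G] : Finite (Monoid.End G) :=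
  finite_monoidHom

end Finiteness

section Permutations

open Equiv Equiv.Perm

variable {α β : Type*} [DecidableEq α] [DecidableEq β]

theorem eq_or_eq_of_not_commute_swap_swap {a b c d : α} (h : ¬ Commute (swap a b) (swap c d)) :
    a = c ∨ a = d ∨ b = c ∨ b = d := by
  by_contra! hne
  have hab : a ≠ b := by
    rintro rfl
    exact h (by simp [← Perm.one_def])
  have hcd : c ≠ d := by
    rintro rfl
    exact h (by simp [← Perm.one_def])
  exact h (disjoint_swap_swap (by simp [*])).commute

theorem not_commute_swap_swap {p u v : α} (hpu : p ≠ u) (hpv : p ≠ v) (huv : u ≠ v) :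
    ¬ Commute (swap p u) (swap p v) := by
  intro h
  have hp : (swap p u * swap p v) p = (swap p v * swap p u) p := congrArg (· p) h.eq
  rw [Perm.mul_apply, Perm.mul_apply, swap_apply_left, swap_apply_left,
    swap_apply_of_ne_of_ne hpv.symm huv.symm, swap_apply_of_ne_of_ne hpu.symm huv] at hp
  exact huv hp.symm

theorem exists_eq_swap_of_not_commute {s t : Perm α} (hs : s.IsSwap) (ht : t.IsSwap)
    (hst : ¬ Commute s t) :
    ∃ p u v, p ≠ u ∧ p ≠ v ∧ u ≠ v ∧ s = swap p u ∧ t = swap p v := by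
  have of_common {p u v : α} (hu : p ≠ u) (hv : p ≠ v) (hs : s = swap p u) (ht : t = swap p v) :
      ∃ p u v, p ≠ u ∧ p ≠ v ∧ u ≠ v ∧ s = swap p u ∧ t = swap p v :=
    ⟨p, u, v, hu, hv, by rintro rfl; exact hst (hs ▸ ht ▸ .refl _), hs, ht⟩
  obtain ⟨a, b, hab, hs⟩ := hs
  obtain ⟨c, d, hcd, ht⟩ := ht
  have hs' : s = swap b a := swap_comm a b ▸ hs
  have ht' : t = swap d c := swap_comm c d ▸ ht
  obtain rfl | rfl | rfl | rfl := eq_or_eq_of_not_commute_swap_swap (hs ▸ ht ▸ hst)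
  · exact of_common hab hcd hs ht
  · exact of_common hab hcd.symm hs ht'
  · exact of_common hab.symm hcd hs' ht
  · exact of_common hab.symm hcd.symm hs' ht'

theorem eq_swap_or_eq_swap_of_not_commute {p u v : α} {t : Perm α} (ht : t.IsSwap) (huv : u ≠ v)
    (hu : ¬ Commute t (swap p u)) (hv : ¬ Commute t (swap p v)) :
    (∃ w, t = swap p w) ∨ t = swap u v := by
  obtain ⟨a, b, -, rfl⟩ := ht
  have := eq_or_eq_of_not_commute_swap_swap hu
  have := eq_or_eq_of_not_commute_swap_swap hv
  grind [swap_comm]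

theorem mul_pow_six_eq_one_of_isSwap {s t : Perm α} (hs : s.IsSwap) (ht : t.IsSwap) :
    (s * t) ^ 6 = 1 := by
  have sq {r : Perm α} (hr : r.IsSwap) : r ^ 2 = 1 := by
    obtain ⟨a, b, -, rfl⟩ := hr
    rw [pow_two, swap_mul_self]
  by_cases hst : Commute s t
  · rw [hst.mul_pow, pow_mul s 2 3, pow_mul t 2 3, sq hs, sq ht, one_pow, mul_one]
  · obtain ⟨p, u, v, hpu, hpv, huv, rfl, rfl⟩ := exists_eq_swap_of_not_commute hs ht hst
    have h3 : (swap p u * swap p v) ^ 3 = 1 := by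
      ext x
      simp only [pow_succ, pow_zero, one_mul, Perm.mul_apply, swap_apply_def, one_apply]
      grind
    rw [pow_mul _ 3 2, h3, one_pow]

/-- `t` reflects the `k`-gon `f`; its product with its conjugate by the rotation `g` of that `k`-gon
is the rotation by two steps. -/
theorem exists_mul_conj_pow_six_ne_one {α : Type*} {k : ℕ} (hk : (12 : ZMod k) ≠ 0)
    (f : ZMod k ↪ α) {t : Perm α} (ht : ∀ i, t (f i) = f (1 - i)) :
    ∃ g, (t * (g * t * g⁻¹)) ^ 6 ≠ 1 := by
  let g : Perm α := (Equiv.addRight (1 : ZMod k)).viaEmbedding f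
  have hg (i : ZMod k) : g (f i) = f (i + 1) := viaEmbedding_apply _ f i
  have hg' (i : ZMod k) : g⁻¹ (f i) = f (i - 1) := by
    rw [inv_eq_iff_eq, hg, sub_add_cancel]
  have hpow (m : ℕ) : ((t * (g * t * g⁻¹)) ^ m) (f 0) = f (-(2 * m : ZMod k)) := by
    induction m with
    | zero => simp
    | succ m ih =>
      rw [pow_succ', Perm.mul_apply, ih]
      simp only [Perm.mul_apply, hg, hg', ht]
      push_cast
      ring_nf
  refine ⟨g, fun h => hk ?_⟩
  have h6 := hpow 6
  rw [h, Perm.one_apply] at h6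
  have := f.injective h6
  push_cast at this
  rw [eq_comm, neg_eq_zero] at this
  rw [← this]
  norm_num

theorem exists_notMem_of_card_lt {α : Type*} [Fintype α] {s : Finset α}
    (hs : s.card < Fintype.card α) : ∃ x, x ∉ s :=
  (Finset.exists_mem_notMem_of_card_lt_card hs).imp fun _ => And.right

theorem exists_mul_conj_pow_six_ne_one_of_apply_eq {α : Type*} {t : Perm α}
    (htt : Function.Involutive t) {a c e : α} (ha : t a ≠ a) (hc : t c ≠ c) (hca : c ≠ a)
    (hcta : c ≠ t a) (he : t e = e) :
    ∃ g, (t * (g * t * g⁻¹)) ^ 6 ≠ 1 := by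
  let v : Fin 5 → α := ![a, t a, c, e, t c]
  have hv : Function.Injective v := by
    refine List.nodup_ofFn.mp ?_
    simp only [v, List.ofFn_succ, List.ofFn_zero, Matrix.cons_val_zero, Matrix.cons_val_succ,
      Matrix.cons_val_fin_one, List.nodup_cons, List.mem_cons, List.not_mem_nil,
      EmbeddingLike.apply_eq_iff_eq]
    grind [Function.Involutive]
  have hreflect : ∀ i : Fin 5, t (v i) = v (1 - i) := by
    simp [Fin.forall_fin_succ, v, htt _, he]
  exact exists_mul_conj_pow_six_ne_one (k := 5) (by decide) ⟨v, hv⟩ hreflect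

theorem exists_mul_conj_pow_six_ne_one_of_forall_apply_ne {t : Perm α}
    (htt : Function.Involutive t) (hfix : ∀ x, t x ≠ x) {a c e x : α} (hca : c ≠ a)
    (hcta : c ≠ t a) (he : e ∉ ({a, t a, c, t c} : Finset α))
    (hx : x ∉ ({a, t a, c, t c, e, t e} : Finset α)) :
    ∃ g, (t * (g * t * g⁻¹)) ^ 6 ≠ 1 := by
  let v : Fin 8 → α := ![a, t a, c, e, x, t x, t e, t c]
  have hv : Function.Injective v := by
    refine List.nodup_ofFn.mp ?_
    simp only [v, List.ofFn_succ, List.ofFn_zero, Matrix.cons_val_zero, Matrix.cons_val_succ,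
      Matrix.cons_val_fin_one, List.nodup_cons, List.mem_cons, List.not_mem_nil,
      EmbeddingLike.apply_eq_iff_eq]
    grind [Function.Involutive]
  have hreflect : ∀ i : Fin 8, t (v i) = v (1 - i) := by
    simp [Fin.forall_fin_succ, v, htt _]
  exact exists_mul_conj_pow_six_ne_one (k := 8) (by decide) ⟨v, hv⟩ hreflect

theorem isSwap_of_forall_mul_conj_pow_six_eq_one [Fintype α] (hα : 7 ≤ Fintype.card α)
    {t : Perm α} (ht1 : t ≠ 1) (ht2 : t ^ 2 = 1)
    (ht6 : ∀ g, (t * (g * t * g⁻¹)) ^ 6 = 1) : t.IsSwap := by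
  have htt : Function.Involutive t := fun x => by
    rw [← Perm.mul_apply, ← pow_two, ht2, Perm.one_apply]
  obtain ⟨a, ha⟩ : ∃ a, t a ≠ a := by
    by_contra! h
    exact ht1 (Perm.ext h)
  by_contra hswap
  obtain ⟨c, hc⟩ : ∃ c, t c ≠ swap a (t a) c := by
    by_contra! h
    exact hswap ⟨a, t a, ha.symm, Perm.ext h⟩
  have hca : c ≠ a := by
    rintro rfl
    exact hc (swap_apply_left _ _).symm
  have hcta : c ≠ t a := by
    rintro rfl
    exact hc (by rw [swap_apply_right, htt])
  rw [swap_apply_of_ne_of_ne hca hcta] at hc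
  suffices ∃ g, (t * (g * t * g⁻¹)) ^ 6 ≠ 1 from this.elim fun g hg => hg (ht6 g)
  by_cases hfix : ∃ e, t e = e
  · obtain ⟨e, he⟩ := hfix
    exact exists_mul_conj_pow_six_ne_one_of_apply_eq htt ha hc hca hcta he
  · push Not at hfix
    obtain ⟨e, he⟩ := exists_notMem_of_card_lt (s := {a, t a, c, t c})
      (Finset.card_le_four.trans_lt (by lia))
    obtain ⟨x, hx⟩ := exists_notMem_of_card_lt (s := {a, t a, c, t c, e, t e})
      (Finset.card_le_six.trans_lt (by lia))
    exact exists_mul_conj_pow_six_ne_one_of_forall_apply_ne htt hfix hca hcta he hx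

theorem isSwap_map_of_injective [Fintype α] (hα : 7 ≤ Fintype.card α)
    {f : Perm α →* Perm α} (hf : Function.Injective f) {t : Perm α} (ht : t.IsSwap) :
    (f t).IsSwap := by
  have ht_conj (g : Perm α) : (g * t * g⁻¹).IsSwap := by
    obtain ⟨a, b, hab, rfl⟩ := ht
    exact ⟨g a, g b, g.injective.ne hab, (swap_apply_apply g a b).symm⟩
  refine isSwap_of_forall_mul_conj_pow_six_eq_one hα ?_ ?_ fun g => ?_
  · rw [ne_eq, map_eq_one_iff f hf]
    exact ht.isCycle.ne_one
  · rw [← map_pow, ← ht.orderOf, pow_orderOf_eq_one, map_one]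
  · obtain ⟨g, rfl⟩ := Finite.surjective_of_injective hf g
    rw [← map_inv, ← map_mul, ← map_mul, ← map_mul, ← map_pow,
      mul_pow_six_eq_one_of_isSwap ht (ht_conj g), map_one]

theorem exists_forall_map_swap_eq [Fintype α] (hα : 2 < Fintype.card α) {f : Perm α →* Perm β}
    (hf : Function.Injective f) (hswap : ∀ t : Perm α, t.IsSwap → (f t).IsSwap) (z : α) :
    ∃ s : α → β, ∀ k, f (swap z k) = swap (s z) (s k) := by
  obtain ⟨i, hi⟩ := exists_notMem_of_card_lt (s := {z}) (by rw [Finset.card_singleton]; lia)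
  obtain ⟨j, hj⟩ := exists_notMem_of_card_lt (s := {z, i}) (Finset.card_le_two.trans_lt hα)
  have hzi : z ≠ i := by grind
  have hzj : z ≠ j := by grind
  have hij : i ≠ j := by grind
  have map_not_commute {s t : Perm α} (h : ¬ Commute s t) : ¬ Commute (f s) (f t) :=
    fun h' => h (h'.of_map hf)
  obtain ⟨p, u, v, -, hpv, huv, hfi, hfj⟩ :=
    exists_eq_swap_of_not_commute (hswap _ ⟨z, i, hzi, rfl⟩) (hswap _ ⟨z, j, hzj, rfl⟩)
      (map_not_commute (not_commute_swap_swap hzi hzj hij))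
  have hfij : f (swap i j) = swap u v := by
    rw [← swap_mul_swap_mul_swap hzj.symm hij.symm, map_mul, map_mul, hfi, swap_comm j z, hfj,
      swap_comm p v, swap_mul_swap_mul_swap hpv.symm huv.symm]
  have star (k : α) : ∃ w, f (swap z k) = swap p w := by
    by_cases hk : z ≠ k ∧ k ≠ i ∧ k ≠ j
    · obtain ⟨hzk, hki, hkj⟩ := hk
      have hk : (f (swap z k)).IsSwap := hswap _ ⟨z, k, hzk, rfl⟩
      refine (eq_swap_or_eq_swap_of_not_commute hk huv ?_ ?_).resolve_right fun h => ?_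
      · exact hfi ▸ map_not_commute (not_commute_swap_swap hzk hzi hki)
      · exact hfj ▸ map_not_commute (not_commute_swap_swap hzk hzj hkj)
      · have := congrArg (· z) (hf (h.trans hfij.symm))
        simp [swap_apply_of_ne_of_ne hzi hzj, hzk.symm] at this
    · obtain rfl | rfl | rfl : k = z ∨ k = i ∨ k = j := by grind
      · exact ⟨p, by rw [swap_self, swap_self, ← Perm.one_def, ← Perm.one_def, map_one]⟩
      · exact ⟨u, hfi⟩
      · exact ⟨v, hfj⟩
  choose s hs using star
  have hsz : p = s z := by
    rw [← swap_eq_one_iff, ← hs, swap_self, ← Perm.one_def, map_one]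
  exact ⟨s, fun k => hsz ▸ hs k⟩

theorem perm_monoidHom_ext_swap [Finite α] {G : Type*} [Group G] {f ψ : Perm α →* G} (z : α)
    (h : ∀ k, f (swap z k) = ψ (swap z k)) : f = ψ := by
  refine MonoidHom.eq_of_eqOn_dense closure_isSwap ?_
  rintro _ ⟨i, j, hij, rfl⟩
  by_cases hi : i = z
  · exact hi ▸ h j
  by_cases hj : j = z
  · rw [hj, swap_comm]
    exact h i
  · rw [← swap_mul_swap_mul_swap hj (Ne.symm hij), swap_comm j z]
    simp only [map_mul, h]

theorem exists_eq_conj_of_injective {α : Type*} [Fintype α] (hα : 7 ≤ Fintype.card α)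
    {f : Perm α →* Perm α} (hf : Function.Injective f) :
    ∃ τ : Perm α, f = (MulAut.conj τ).toMonoidHom := by
  classical
  obtain ⟨z⟩ : Nonempty α := Fintype.card_pos_iff.mp (by lia)
  obtain ⟨s, hs⟩ := exists_forall_map_swap_eq (by lia) hf
    (fun t => isSwap_map_of_injective hα hf) z
  have hsinj : Function.Injective s := fun k l hkl => by
    have : swap z k = swap z l := hf (by rw [hs, hs, hkl])
    simpa using congrArg (· z) this
  refine ⟨Equiv.ofBijective s (Finite.injective_iff_bijective.mp hsinj),
    perm_monoidHom_ext_swap z fun k => ?_⟩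
  rw [hs]
  exact swap_apply_apply (Equiv.ofBijective s _) z k

end Permutations

section NormalSubgroups

open Equiv SemidirectProduct

variable {α : Type*} [Fintype α]

theorem alternatingGroup_le_of_normal_of_ne_bot [DecidableEq α] (hα : 5 ≤ Fintype.card α)
    {N : Subgroup (Perm α)} [N.Normal] (hN : N ≠ ⊥) : alternatingGroup α ≤ N :=
  Perm.alternatingGroup_le_of_normal (Nat.card_eq_fintype_card (α := α) ▸ hα)
    ((Subgroup.nontrivial_iff_ne_bot N).mpr hN)

theorem perm_subgroup_eq_bot_of_isMulCommutative (hα : 5 ≤ Fintype.card α) (N : Subgroup (Perm α))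
    [N.Normal] [IsMulCommutative N] : N = ⊥ := by
  classical
  by_contra hN
  have hle := alternatingGroup_le_of_normal_of_ne_bot hα hN
  have : IsMulCommutative (alternatingGroup α) :=
    .of_setLike_mul_comm fun _ ha _ hb => setLike_mul_comm (hle ha) (hle hb)
  have := alternatingGroup.isMulCommutative_iff_card_le_three.mp this
  rw [Nat.card_eq_fintype_card] at this
  lia

theorem mulAut_conj_perm_injective (hα : 5 ≤ Fintype.card α) :
    Function.Injective (MulAut.conj (G := Perm α)) := by
  rw [injective_iff_map_eq_one]
  intro τ hτ
  have hcenter : τ ∈ Subgroup.center (Perm α) := Subgroup.mem_center_iff.mpr fun σ => by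
    have := DFunLike.congr_fun hτ σ
    rw [MulAut.conj_apply, MulAut.one_apply, mul_inv_eq_iff_eq_mul] at this
    exact this.symm
  rwa [perm_subgroup_eq_bot_of_isMulCommutative hα (Subgroup.center _), Subgroup.mem_bot] at hcenter

variable {N G : Type*} [CommGroup N] [Group G] {ρ : G →* MulAut N}

theorem comp_inl_eq_one_of_surjective (hα : 5 ≤ Fintype.card α) {F : N ⋊[ρ] G →* Perm α}
    (hF : Function.Surjective F) : F.comp inl = 1 := by
  have hnormal : (F.comp inl).range.Normal := by
    rw [MonoidHom.range_comp, range_inl_eq_ker_rightHom]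
    exact Subgroup.Normal.map inferInstance F hF
  exact MonoidHom.range_eq_bot_iff.mp (perm_subgroup_eq_bot_of_isMulCommutative hα _)

theorem injective_rightHom_comp (hα : 5 ≤ Fintype.card α) {ψ : Perm α →* N ⋊[ρ] G}
    (hψ : Function.Injective ψ) : Function.Injective (rightHom.comp ψ) := by
  rw [← MonoidHom.ker_eq_bot_iff]
  have hker : (rightHom.comp ψ).ker = (inl : N →* N ⋊[ρ] G).range.comap ψ := by
    rw [range_inl_eq_ker_rightHom, MonoidHom.comap_ker]
  have : IsMulCommutative (rightHom.comp ψ).ker :=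
    hker ▸ Subgroup.comap_injective_isMulCommutative _ hψ
  exact perm_subgroup_eq_bot_of_isMulCommutative hα _

theorem alternatingGroup_le_ker_of_not_injective [DecidableEq α] (hα : 5 ≤ Fintype.card α)
    {ψ : Perm α →* N ⋊[ρ] G} (hψ : ¬ Function.Injective (rightHom.comp ψ)) :
    alternatingGroup α ≤ ψ.ker :=
  alternatingGroup_le_of_normal_of_ne_bot hα fun h =>
    hψ (injective_rightHom_comp hα ((MonoidHom.ker_eq_bot_iff ψ).mp h))

end NormalSubgroups

section CrossedHomomorphisms

open SemidirectProduct

variable {N G : Type*} [CommGroup N] [Group G] (ρ : G →* MulAut N)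

/-- The endomorphisms of `N` that commute with the action `ρ` of `G`. -/
def equivariantEnd : Set (N →* N) :=
  {θ | ∀ g n, θ (ρ g n) = ρ g (θ n)}

/-- The crossed homomorphisms (1-cocycles) from `G` to the `G`-module `N`. -/
def crossedHom : Set (G → N) :=
  {c | ∀ g h, c (g * h) = c g * ρ g (c h)}

variable {ρ}

theorem crossedHom_one {c : G → N} (hc : c ∈ crossedHom ρ) : c 1 = 1 := by
  simpa using hc 1 1

/-- The endomorphism `(n, g) ↦ (θ n * c g, g)` of `N ⋊[ρ] G`. -/
def twistEnd {θ : N →* N} (hθ : θ ∈ equivariantEnd ρ) {c : G → N} (hc : c ∈ crossedHom ρ) :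
    N ⋊[ρ] G →* N ⋊[ρ] G where
  toFun x := ⟨θ x.left * c x.right, x.right⟩
  map_one' := by simp [crossedHom_one hc]
  map_mul' x y := by
    ext
    · simp only [mul_left, mul_right, map_mul, hθ _ _, hc _ _]
      ac_rfl
    · rfl

theorem rightHom_comp_twistEnd {θ : N →* N} (hθ : θ ∈ equivariantEnd ρ) {c : G → N}
    (hc : c ∈ crossedHom ρ) : rightHom.comp (twistEnd hθ hc) = rightHom := rfl

variable (ρ) in
/-- An endomorphism of `N ⋊[ρ] G` over `G` amounts to an equivariant endomorphism of `N`, its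
restriction, together with a crossed homomorphism, its first component on `G`. -/
def endOverEquiv :
    {f : N ⋊[ρ] G →* N ⋊[ρ] G // rightHom.comp f = rightHom} ≃
      equivariantEnd ρ × crossedHom ρ where
  toFun f :=
    have right_map (x : N ⋊[ρ] G) : (f.1 x).right = x.right := DFunLike.congr_fun f.2 x
    ⟨⟨{ toFun n := (f.1 (inl n)).left
        map_one' := by rw [map_one, map_one, one_left]
        map_mul' m n := by simp [right_map] },
      fun g n => by simp [inl_aut, right_map]⟩,
     ⟨fun g => (f.1 (inr g)).left, fun g h => by simp [right_map]⟩⟩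
  invFun p := ⟨twistEnd p.1.2 p.2.2, rightHom_comp_twistEnd p.1.2 p.2.2⟩
  left_inv f := by
    have right_map (x : N ⋊[ρ] G) : (f.1 x).right = x.right := DFunLike.congr_fun f.2 x
    refine Subtype.ext (hom_ext (MonoidHom.ext fun n => ?_) (MonoidHom.ext fun g => ?_))
    · ext
      · simp only [twistEnd, MonoidHom.comp_apply, MonoidHom.coe_mk, OneHom.coe_mk, left_inl,
          right_inl, map_one, one_left, mul_one]
      · exact (right_map (inl n)).symm
    · ext
      · simp only [twistEnd, MonoidHom.comp_apply, MonoidHom.coe_mk, OneHom.coe_mk, left_inr,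
          right_inr, map_one, one_left, one_mul]
      · exact (right_map (inr g)).symm
  right_inv p := by
    refine Prod.ext (Subtype.ext (MonoidHom.ext fun n => ?_)) (Subtype.ext (funext fun g => ?_))
    · simp [twistEnd, crossedHom_one p.2.2]
    · simp [twistEnd]

end CrossedHomomorphisms

section Shapiro

open MulAction

variable {G X M : Type*} [Group G] [MulAction G X] [CommGroup M] {x₀ : X} {t : X → G}

theorem mem_crossedHom_mulAutArrow {c : G → X → M} :
    c ∈ crossedHom (mulAutArrow : G →* MulAut (X → M)) ↔
      ∀ g h x, c (g * h) x = c g x * c h (g⁻¹ • x) :=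
  forall₂_congr fun _ _ => funext_iff

/-- For a transversal `t` of the stabilizer of `x₀`, the element of that stabilizer by which
`g * t (g⁻¹ • x)` differs from `t x`. -/
def stabilizerFactor (ht : ∀ x, t x • x₀ = x) (g : G) (x : X) : stabilizer G x₀ :=
  ⟨(t x)⁻¹ * g * t (g⁻¹ • x), by simp [mem_stabilizer_iff, mul_smul, ht, inv_smul_eq_iff]⟩

theorem stabilizerFactor_mul (ht : ∀ x, t x • x₀ = x) (g h : G) (x : X) :
    stabilizerFactor ht (g * h) x = stabilizerFactor ht g x * stabilizerFactor ht h (g⁻¹ • x) := by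
  ext
  simp only [stabilizerFactor, Subgroup.coe_mul, mul_inv_rev, mul_smul]
  group

theorem mul_stabilizerFactor (ht : ∀ x, t x • x₀ = x) (g : G) (x : X) :
    t x * stabilizerFactor ht g x = g * t (g⁻¹ • x) := by
  simp only [stabilizerFactor]
  group

theorem stabilizerFactor_coe (ht : ∀ x, t x • x₀ = x) (ht₀ : t x₀ = 1) (s : stabilizer G x₀) :
    stabilizerFactor ht s x₀ = s := by
  ext
  simp only [stabilizerFactor, mem_stabilizer_iff.mp (inv_mem s.2), ht₀, inv_one, one_mul, mul_one]

theorem stabilizerFactor_transversal (ht : ∀ x, t x • x₀ = x) (ht₀ : t x₀ = 1) (x : X) :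
    stabilizerFactor ht (t x) x = 1 := by
  ext
  simp only [stabilizerFactor, inv_smul_eq_iff.mpr (ht x).symm, ht₀, inv_mul_cancel, mul_one,
    Subgroup.coe_one]

/-- Shapiro's lemma for the crossed homomorphisms with values in a coinduced module, with the
coboundaries accounted for by the functions `X → M`: `χ` and `u` correspond to
`c g x = u x * χ ((t x)⁻¹ * g * t (g⁻¹ • x)) / u (g⁻¹ • x)` and `m = u x₀`. -/
def crossedHomProdEquiv (ht : ∀ x, t x • x₀ = x) (ht₀ : t x₀ = 1) :
    crossedHom (mulAutArrow : G →* MulAut (X → M)) × M ≃ (stabilizer G x₀ →* M) × (X → M) where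
  toFun p :=
    ({  toFun s := p.1.1 s x₀
        map_one' := congrFun (crossedHom_one p.1.2) x₀
        map_mul' s r := by
          rw [Subgroup.coe_mul, mem_crossedHom_mulAutArrow.mp p.1.2,
            mem_stabilizer_iff.mp (inv_mem s.2)] },
     fun x => p.1.1 (t x) x * p.2)
  invFun p :=
    (⟨fun g x => p.2 x * p.1 (stabilizerFactor ht g x) / p.2 (g⁻¹ • x),
      mem_crossedHom_mulAutArrow.mpr fun g h x => by
        rw [stabilizerFactor_mul, map_mul, mul_inv_rev, mul_smul, ← mul_assoc,
          mul_div_right_comm, mul_div_right_comm (p.2 (g⁻¹ • x)), ← mul_assoc,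
          div_mul_div_cancel]⟩,
     p.2 x₀)
  left_inv p := by
    obtain ⟨⟨c, hc⟩, m⟩ := p
    have hc' := mem_crossedHom_mulAutArrow.mp hc
    refine Prod.ext (Subtype.ext (funext₂ fun g x => ?_)) ?_
    · have hx : (t x)⁻¹ • x = x₀ := inv_smul_eq_iff.mpr (ht x).symm
      have := congrArg (c · x) (mul_stabilizerFactor ht g x)
      simp only [hc', hx] at this
      change c (t x) x * m * c (stabilizerFactor ht g x) x₀ /
        (c (t (g⁻¹ • x)) (g⁻¹ • x) * m) = c g x
      rw [mul_right_comm, this, mul_assoc, mul_div_cancel_right]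
    · change c (t x₀) x₀ * m = m
      rw [ht₀, crossedHom_one hc, Pi.one_apply, one_mul]
  right_inv p := by
    obtain ⟨χ, u⟩ := p
    refine Prod.ext (MonoidHom.ext fun s => ?_) (funext fun x => ?_)
    · have hs : (s : G)⁻¹ • x₀ = x₀ := mem_stabilizer_iff.mp (inv_mem s.2)
      change u x₀ * χ (stabilizerFactor ht s x₀) / u ((s : G)⁻¹ • x₀) = χ s
      rw [stabilizerFactor_coe ht ht₀, hs, mul_div_cancel_left]
    · have hx : (t x)⁻¹ • x = x₀ := inv_smul_eq_iff.mpr (ht x).symm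
      change u x * χ (stabilizerFactor ht (t x) x) / u ((t x)⁻¹ • x) * u x₀ = u x
      rw [stabilizerFactor_transversal ht ht₀, hx, map_one, mul_one, div_mul_cancel]

theorem card_crossedHom_mulAutArrow_mul [IsPretransitive G X] [Finite X] (x₀ : X) :
    Nat.card (crossedHom (mulAutArrow : G →* MulAut (X → M))) * Nat.card M =
      Nat.card (stabilizer G x₀ →* M) * Nat.card M ^ Nat.card X := by
  classical
  choose s hs using fun x => exists_smul_eq G x₀ x
  have ht (x : X) : (if x = x₀ then 1 else s x) • x₀ = x := by
    split_ifs with h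
    · rw [one_smul, h]
    · exact hs x
  rw [← Nat.card_prod, Nat.card_congr (crossedHomProdEquiv ht (if_pos rfl)), Nat.card_prod,
    Nat.card_fun]

end Shapiro

section EquivariantEndomorphisms

open MulAction

variable {G X M : Type*} [Group G] [MulAction G X] [CommGroup M]

theorem mulAutArrow_mulSingle [DecidableEq X] (g : G) (x : X) (m : M) :
    mulAutArrow g (Pi.mulSingle x m : X → M) = Pi.mulSingle (g • x) m := by
  ext y
  change (Pi.mulSingle x m : X → M) (g⁻¹ • y) = _
  simp only [Pi.mulSingle_apply, inv_smul_eq_iff]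

theorem apply_mulSingle_smul [DecidableEq X] {θ : (X → M) →* (X → M)}
    (hθ : θ ∈ equivariantEnd (mulAutArrow : G →* MulAut (X → M))) (g : G) (x y : X) (m : M) :
    θ (Pi.mulSingle (g • x) m) (g • y) = θ (Pi.mulSingle x m) y := by
  rw [← mulAutArrow_mulSingle, hθ]
  change θ (Pi.mulSingle x m) (g⁻¹ • g • y) = _
  rw [inv_smul_smul]

/-- The endomorphism of `X → M` given by the square matrix with entries `a` on the diagonal and
`b` off the diagonal. -/
def diagonalOffDiagonal [Fintype X] [DecidableEq X] (a b : M →* M) : (X → M) →* (X → M) :=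
  MonoidHom.pi fun x => ∏ y, (if y = x then a else b).comp (Pi.evalMonoidHom _ y)

theorem diagonalOffDiagonal_apply [Fintype X] [DecidableEq X] (a b : M →* M) (u : X → M) (x : X) :
    diagonalOffDiagonal a b u x = ∏ y, (if y = x then a else b) (u y) := by
  simp only [diagonalOffDiagonal, MonoidHom.pi_apply, MonoidHom.finsetProd_apply,
    MonoidHom.comp_apply, Pi.evalMonoidHom_apply]

theorem diagonalOffDiagonal_mulSingle [Fintype X] [DecidableEq X] (a b : M →* M) (x y : X) (m : M) :
    diagonalOffDiagonal a b (Pi.mulSingle x m) y = (if x = y then a else b) m := by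
  rw [diagonalOffDiagonal_apply, Fintype.prod_eq_single x fun z hz => by
    rw [Pi.mulSingle_eq_of_ne hz, map_one], Pi.mulSingle_eq_same]

theorem diagonalOffDiagonal_mem_equivariantEnd [Fintype X] [DecidableEq X] (a b : M →* M) :
    diagonalOffDiagonal a b ∈ equivariantEnd (mulAutArrow : G →* MulAut (X → M)) := by
  intro g u
  ext x
  change diagonalOffDiagonal a b (fun y => u (g⁻¹ • y)) x = diagonalOffDiagonal a b u (g⁻¹ • x)
  rw [diagonalOffDiagonal_apply, diagonalOffDiagonal_apply, ← Equiv.prod_comp (toPerm g)]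
  simp only [toPerm_apply, inv_smul_smul, eq_inv_smul_iff]

theorem card_equivariantEnd_mulAutArrow [Finite X] [Nontrivial X] [IsMultiplyPretransitive G X 2] :
    Nat.card (equivariantEnd (mulAutArrow : G →* MulAut (X → M))) = Nat.card (M →* M) ^ 2 := by
  classical
  have := Fintype.ofFinite X
  obtain ⟨x₀, y₀, hxy⟩ := exists_pair_ne X
  let entry (θ : (X → M) →* (X → M)) (x y : X) : M →* M :=
    (Pi.evalMonoidHom _ y).comp (θ.comp (MonoidHom.mulSingle _ x))
  rw [sq, ← Nat.card_prod]
  refine Nat.card_congr ⟨fun θ => (entry θ x₀ x₀, entry θ x₀ y₀), fun p =>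
    ⟨diagonalOffDiagonal p.1 p.2, diagonalOffDiagonal_mem_equivariantEnd p.1 p.2⟩,
    fun θ => Subtype.ext (MonoidHom.pi_ext fun x m => funext fun y => ?_), fun p => ?_⟩
  · rw [diagonalOffDiagonal_mulSingle]
    split_ifs with h
    · subst h
      have := isPretransitive_of_is_two_pretransitive (G := G) (α := X)
      obtain ⟨g, rfl⟩ := exists_smul_eq G x₀ x
      exact (apply_mulSingle_smul θ.2 g x₀ x₀ m).symm
    · obtain ⟨g, rfl, rfl⟩ := is_two_pretransitive_iff.mp ‹_› hxy h
      exact (apply_mulSingle_smul θ.2 g x₀ y₀ m).symm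
  · refine Prod.ext (MonoidHom.ext fun m => ?_) (MonoidHom.ext fun m => ?_)
    · exact (diagonalOffDiagonal_mulSingle p.1 p.2 x₀ x₀ m).trans (by rw [if_pos rfl])
    · exact (diagonalOffDiagonal_mulSingle p.1 p.2 x₀ y₀ m).trans (by rw [if_neg hxy])

end EquivariantEndomorphisms

section PermHoms

open Equiv MulAction

theorem card_perm_monoidHom {X M : Type*} [Finite X] [CommGroup M] (hX : 5 ≤ Nat.card X) :
    Nat.card (Perm X →* M) = Nat.card (ℤˣ →* M) := by
  classical
  have := Fintype.ofFinite X
  have : Nontrivial X := Finite.one_lt_card_iff_nontrivial.mp (by lia)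
  have hker (f : Perm X →* M) : (Perm.sign (α := X)).ker ≤ f.ker := by
    rw [← alternatingGroup_eq_sign_ker, ← alternatingGroup.commutator_perm_eq hX]
    exact Abelianization.commutator_subset_ker f
  exact Nat.card_congr ((Equiv.subtypeUnivEquiv hker).symm.trans
    (MonoidHom.liftOfSurjective _ (Perm.sign_surjective X)))

/-- A permutation of the points other than `x₀`, seen as a permutation fixing `x₀`. -/
noncomputable def permNeEquivStabilizer {X : Type*} (x₀ : X) :
    Perm {x // x ≠ x₀} ≃* stabilizer (Perm X) x₀ := by
  classical
  refine MulEquiv.ofBijective ((Perm.ofSubtype (p := (· ≠ x₀))).codRestrict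
    (stabilizer (Perm X) x₀) fun σ => Perm.ofSubtype_apply_of_not_mem σ (not_not_intro rfl))
    ⟨fun σ τ h => Perm.ofSubtype_injective (congrArg Subtype.val h), fun τ => ?_⟩
  have hτ₀ : τ.1 x₀ = x₀ := τ.2
  have hτ (x : X) : τ.1 x ≠ x₀ ↔ x ≠ x₀ :=
    not_congr ⟨fun h => τ.1.injective (h.trans hτ₀.symm), fun h => h ▸ hτ₀⟩
  exact ⟨τ.1.subtypePerm hτ, Subtype.ext (Perm.ofSubtype_subtypePerm hτ fun x hx hx₀ =>
    hx (hx₀ ▸ hτ₀))⟩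

theorem card_stabilizer_perm_monoidHom {X M : Type*} [Finite X] [CommGroup M]
    (hX : 6 ≤ Nat.card X) (x₀ : X) :
    Nat.card (stabilizer (Perm X) x₀ →* M) = Nat.card (ℤˣ →* M) := by
  classical
  have hcompl : Nat.card {x // x ≠ x₀} + 1 = Nat.card X := by
    rw [← Finite.card_option, Nat.card_congr (optionSubtypeNe x₀)]
  rw [← card_perm_monoidHom (X := {x // x ≠ x₀}) (by lia)]
  exact Nat.card_congr (permNeEquivStabilizer x₀).symm.monoidHomCongrLeftEquiv

end PermHoms

section QuotientPart

open SemidirectProduct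

variable {N G : Type*} [CommGroup N] [Group G] {ρ : G →* MulAut N}

/-- The endomorphism of `G` induced by an endomorphism of `N ⋊[ρ] G` through the inclusion of `G`
and the projection onto it. -/
def quotientPart (f : N ⋊[ρ] G →* N ⋊[ρ] G) : G →* G :=
  (rightHom.comp f).comp inr

theorem quotientPart_conj_inr_comp (g : G) (f : N ⋊[ρ] G →* N ⋊[ρ] G) :
    quotientPart ((MulAut.conj (inr g)).toMonoidHom.comp f) =
      (MulAut.conj g).toMonoidHom.comp (quotientPart f) := by
  ext h
  simp [quotientPart]

theorem quotientPart_eq_id {f : N ⋊[ρ] G →* N ⋊[ρ] G} (hf : rightHom.comp f = rightHom) :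
    quotientPart f = .id G := by
  rw [quotientPart, hf, rightHom_comp_inr]

theorem card_le_card_range_of_injective_quotientPart [Finite N] [Finite G]
    {f : N ⋊[ρ] G →* N ⋊[ρ] G} (hf : Function.Injective (quotientPart f)) :
    Nat.card G ≤ Nat.card f.range := by
  exact Nat.card_le_card_of_injective (fun g => ⟨f (inr g), _, rfl⟩) fun _ _ h =>
    hf (congrArg (rightHom ∘ Subtype.val) h)

end QuotientPart

section InjectiveQuotientPart

open Equiv SemidirectProduct

variable {N : Type*} [CommGroup N] {α : Type*} [Fintype α] {ρ : Perm α →* MulAut N}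

theorem rightHom_comp_eq_of_injective_quotientPart (hα : 7 ≤ Fintype.card α)
    {f : N ⋊[ρ] Perm α →* N ⋊[ρ] Perm α} (hf : Function.Injective (quotientPart f)) :
    ∃ τ, rightHom.comp f = (MulAut.conj τ).toMonoidHom.comp rightHom := by
  obtain ⟨τ, hτ⟩ := exists_eq_conj_of_injective hα hf
  have hsurj : Function.Surjective (quotientPart f) := hτ ▸ (MulAut.conj τ).surjective
  refine ⟨τ, hom_ext ?_ hτ⟩
  rw [comp_inl_eq_one_of_surjective (F := rightHom.comp f) (by lia) (.of_comp (g := inr) hsurj),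
    MonoidHom.comp_assoc, rightHom_comp_inl, MonoidHom.comp_one]

/-- An endomorphism of `N ⋊[ρ] Perm α` with injective quotient part is, up to an inner
automorphism, an endomorphism over `Perm α`. -/
noncomputable def injectiveQuotientPartEquiv (hα : 7 ≤ Fintype.card α) :
    Perm α × {f : N ⋊[ρ] Perm α →* N ⋊[ρ] Perm α // rightHom.comp f = rightHom} ≃
      {f : N ⋊[ρ] Perm α →* N ⋊[ρ] Perm α // Function.Injective (quotientPart f)} := by
  have hpart (τ : Perm α)
      (f : {f : N ⋊[ρ] Perm α →* N ⋊[ρ] Perm α // rightHom.comp f = rightHom}) :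
      quotientPart ((MulAut.conj (inr τ)).toMonoidHom.comp f.1) =
        (MulAut.conj τ).toMonoidHom := by
    rw [quotientPart_conj_inr_comp, quotientPart_eq_id f.2, MonoidHom.comp_id]
  refine .ofBijective (fun p => ⟨(MulAut.conj (inr p.1)).toMonoidHom.comp p.2.1,
    hpart p.1 p.2 ▸ (MulAut.conj p.1).injective⟩) ⟨fun p q h => ?_, fun f => ?_⟩
  · have hpq := congrArg Subtype.val h
    have hconj : MulAut.conj p.1 = MulAut.conj q.1 := MulEquiv.toMonoidHom_injective <| by
      rw [← hpart p.1 p.2, ← hpart q.1 q.2]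
      exact congrArg quotientPart hpq
    have hτ := mulAut_conj_perm_injective (by lia) hconj
    dsimp only at hpq
    rw [hτ] at hpq
    exact Prod.ext hτ (Subtype.ext ((MonoidHom.cancel_left (MulEquiv.injective _)).mp hpq))
  · obtain ⟨τ, hτ⟩ := rightHom_comp_eq_of_injective_quotientPart hα f.2
    refine ⟨(τ, ⟨(MulAut.conj (inr τ⁻¹)).toMonoidHom.comp f.1, MonoidHom.ext fun x => ?_⟩),
      Subtype.ext (MonoidHom.ext fun x => ?_)⟩
    · have hx : (f.1 x).right = τ * x.right * τ⁻¹ := DFunLike.congr_fun hτ x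
      change τ⁻¹ * (f.1 x).right * τ⁻¹⁻¹ = x.right
      rw [hx]
      group
    · simp [mul_assoc]

theorem card_injective_quotientPart (hα : 7 ≤ Fintype.card α) :
    Nat.card {f : N ⋊[ρ] Perm α →* N ⋊[ρ] Perm α // Function.Injective (quotientPart f)} =
      (Fintype.card α) ! * (Nat.card (equivariantEnd ρ) * Nat.card (crossedHom ρ)) := by
  classical
  rw [← Nat.card_congr (injectiveQuotientPartEquiv hα), Nat.card_prod,
    Nat.card_congr (endOverEquiv ρ), Nat.card_prod, Nat.card_perm, Nat.card_eq_fintype_card]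

end InjectiveQuotientPart

section PermWreath

open Equiv SemidirectProduct

/-- The permutational wreath product of `M` with the symmetric group on `X`. -/
abbrev PermWreath (M X : Type*) [Group M] : Type _ :=
  (X → M) ⋊[mulAutArrow] Perm X

variable {M X : Type*} [CommGroup M] [Fintype X]

theorem PermWreath.card {M : Type*} [Group M] :
    Nat.card (PermWreath M X) = Nat.card M ^ Fintype.card X * (Fintype.card X) ! := by
  classical
  rw [SemidirectProduct.card, Nat.card_fun, Nat.card_perm, Nat.card_eq_fintype_card (α := X)]

theorem card_injective_quotientPart_mul (hX : 7 ≤ Fintype.card X) :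
    Nat.card {f : PermWreath M X →* PermWreath M X // Function.Injective (quotientPart f)} *
        Nat.card M =
      Nat.card (M →* M) ^ 2 * Nat.card (ℤˣ →* M) * Nat.card M ^ Fintype.card X *
        (Fintype.card X) ! := by
  have := Perm.isMultiplyPretransitive X 2
  have : Nontrivial X := Fintype.one_lt_card_iff_nontrivial.mp (by lia)
  obtain ⟨x₀⟩ := this.to_nonempty
  rw [card_injective_quotientPart hX, card_equivariantEnd_mulAutArrow, mul_assoc, mul_assoc,
    card_crossedHom_mulAutArrow_mul x₀, card_stabilizer_perm_monoidHom
      (by rw [Nat.card_eq_fintype_card]; lia), Nat.card_eq_fintype_card (α := X)]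
  ring

section ProdSign

variable [DecidableEq X]

/-- The product of the `M`-components of an element of `PermWreath M X`, together with the sign of
its permutation. -/
def prodSign : PermWreath M X →* M × ℤˣ where
  toFun w := (∏ x, w.left x, Perm.sign w.right)
  map_one' := by simp
  map_mul' v w := by
    refine Prod.ext ?_ (map_mul Perm.sign v.right w.right)
    change ∏ x, v.left x * w.left (v.right⁻¹ x) = _
    rw [Finset.prod_mul_distrib, Equiv.prod_comp]
    rfl

theorem prodSign_surjective [Nontrivial X] :
    Function.Surjective (prodSign : PermWreath M X →* M × ℤˣ) := by
  rintro ⟨m, ε⟩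
  obtain ⟨σ, rfl⟩ := Perm.sign_surjective X ε
  obtain ⟨x₀⟩ := ‹Nontrivial X›.to_nonempty
  exact ⟨⟨Pi.mulSingle x₀ m, σ⟩, Prod.ext (Finset.prod_pi_mulSingle' x₀ m _ |>.trans (by simp)) rfl⟩

theorem ker_prodSign_le {H : Type*} [Group H] (hX : 3 ≤ Fintype.card X) {f : PermWreath M X →* H}
    (hf : alternatingGroup X ≤ (f.comp inr).ker) : prodSign.ker ≤ f.ker := by
  have := alternatingGroup.isPretransitive_of_three_le_card X
    (Nat.card_eq_fintype_card (α := X) ▸ hX)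
  obtain ⟨x₀⟩ : Nonempty X := Fintype.card_pos_iff.mp (by lia)
  have hsingle (x : X) (m : M) :
      f (inl (Pi.mulSingle x m)) = f (inl (Pi.mulSingle x₀ m)) := by
    obtain ⟨⟨σ, hσ⟩, rfl⟩ := MulAction.exists_smul_eq (alternatingGroup X) x₀ x
    have hσ : f (inr σ) = 1 := hf hσ
    rw [show (⟨σ, _⟩ : alternatingGroup X) • x₀ = σ • x₀ from rfl, ← mulAutArrow_mulSingle,
      inl_aut, map_mul, map_mul, map_inv, map_inv, hσ]
    group
  have hinl : f.comp inl = (f.comp inl).comp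
      ((MonoidHom.mulSingle _ x₀).comp (∏ x, Pi.evalMonoidHom _ x)) :=
    MonoidHom.pi_ext fun x m => (hsingle x m).trans (by simp)
  intro w hw
  have hprod : ∏ x, w.left x = 1 := congrArg Prod.fst hw
  have hsign : Perm.sign w.right = 1 := congrArg Prod.snd hw
  have hleft : f (inl w.left) = 1 := by
    refine (DFunLike.congr_fun hinl w.left).trans ?_
    simp only [MonoidHom.comp_apply, MonoidHom.finsetProd_apply, Pi.evalMonoidHom_apply, hprod,
      map_one]
  have hright : f (inr w.right) = 1 := hf hsign
  rw [MonoidHom.mem_ker, ← inl_left_mul_inr_right w, map_mul, hleft, hright, one_mul]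

end ProdSign

theorem card_not_injective_quotientPart_le [Finite M] (hX : 5 ≤ Fintype.card X) :
    Nat.card {f : PermWreath M X →* PermWreath M X // ¬ Function.Injective (quotientPart f)} ≤
      Nat.card (M × ℤˣ →* PermWreath M X) := by
  classical
  have : Nontrivial X := Fintype.one_lt_card_iff_nontrivial.mp (by lia)
  have hker (f : {f : PermWreath M X →* PermWreath M X // ¬ Function.Injective (quotientPart f)}) :
      prodSign.ker ≤ f.1.ker :=
    ker_prodSign_le (by lia) (alternatingGroup_le_ker_of_not_injective hX f.2)
  exact Nat.card_le_card_of_injective _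
    ((MonoidHom.liftOfSurjective prodSign prodSign_surjective).injective.comp
      (f := fun f => ⟨f.1, hker f⟩) fun _ _ h => Subtype.ext (congrArg (fun f => f.1) h))

end PermWreath

section OrbitCoding

open Equiv SemidirectProduct

variable {V X : Type*} [Group V] {f f' : V →* Perm X} {r : X → X} {g : X → V}

/-- `r` picks a representative of each orbit of the action `f`, and `g x` carries the
representative `r x` to `x`. -/
def IsOrbitCoding (f : V →* Perm X) (r : X → X) (g : X → V) : Prop :=
  (∀ v x, r (f v x) = r x) ∧ ∀ x, f (g x) (r x) = x

theorem exists_isOrbitCoding (f : V →* Perm X) : ∃ r g, IsOrbitCoding f r g := by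
  let := MulAction.compHom X f
  let orbits : Setoid X := MulAction.orbitRel V X
  have hrepr (x : X) : ∃ v : V, v • (Quotient.mk orbits x).out = x :=
    orbits.symm (Quotient.mk_out x)
  choose g hg using hrepr
  exact ⟨_, g, fun v x => congrArg Quotient.out (Quotient.sound (s := orbits) ⟨v, rfl⟩), hg⟩

namespace IsOrbitCoding

theorem idempotent (h : IsOrbitCoding f r g) (x : X) : r (r x) = r x := by
  rw [← h.1 (g x) (r x), h.2]

theorem card_le_card_mul_card_fixed [Finite V] [Finite X] (h : IsOrbitCoding f r g) :
    Nat.card X ≤ Nat.card V * Nat.card {x // r x = x} := by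
  rw [← Nat.card_prod]
  refine Nat.card_le_card_of_injective
    (fun x => (g x, (⟨r x, h.idempotent x⟩ : {x // r x = x}))) fun x y hxy => ?_
  have hg : g x = g y := congrArg Prod.fst hxy
  have hr : r x = r y := congrArg (fun p => (p.2 : X)) hxy
  rw [← h.2 x, ← h.2 y, hg, hr]

theorem card_moved_le [Finite V] [Finite X] (h : IsOrbitCoding f r g) :
    Nat.card {x // r x ≠ x} ≤ (Nat.card V - 1) * Nat.card X / Nat.card V := by
  classical
  have hcompl : Nat.card {x // r x = x} + Nat.card {x // r x ≠ x} = Nat.card X := by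
    rw [← Nat.card_sum, Nat.card_congr (sumCompl _)]
  rw [Nat.le_div_iff_mul_le Nat.card_pos, Nat.sub_one_mul, Nat.le_sub_iff_add_le
    (Nat.le_mul_of_pos_left _ Nat.card_pos)]
  nlinarith [h.card_le_card_mul_card_fixed]

theorem monoidHom_ext (h : IsOrbitCoding f r g) (h' : IsOrbitCoding f' r g)
    (hg : ∀ v x, g (f v x) = g (f' v x)) : f = f' := by
  refine MonoidHom.ext fun v => Equiv.ext fun x => ?_
  rw [← h'.2 (f v x), h.1, hg, ← h'.1 v x, h'.2]

end IsOrbitCoding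

theorem card_functions_moving_le [Finite X] [Nonempty X] (k : ℕ) :
    Nat.card {r : X → X // Nat.card {x // r x ≠ x} ≤ k} ≤ 2 ^ Nat.card X * Nat.card X ^ k := by
  classical
  have := Fintype.ofFinite X
  let extend (p : Σ s : {s : Finset X // s.card ≤ k}, (s.1 → X)) (x : X) : X :=
    if hx : x ∈ p.1.1 then p.2 ⟨x, hx⟩ else x
  have hextend (p) : Nat.card {x // extend p x ≠ x} ≤ k := by
    rw [Nat.card_eq_fintype_card, Fintype.card_subtype]
    refine (Finset.card_le_card fun x hx => ?_).trans p.1.2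
    by_contra hxs
    exact (Finset.mem_filter.mp hx).2 (dif_neg hxs)
  have hsurj : Function.Surjective fun p =>
      (⟨extend p, hextend p⟩ : {r : X → X // Nat.card {x // r x ≠ x} ≤ k}) := by
    rintro ⟨r, hr⟩
    rw [Nat.card_eq_fintype_card, Fintype.card_subtype] at hr
    refine ⟨⟨⟨_, hr⟩, fun x => r x⟩, Subtype.ext (funext fun x => ?_)⟩
    by_cases hx : r x = x <;> simp [extend, hx]
  refine (Nat.card_le_card_of_surjective _ hsurj).trans ?_
  calc Nat.card (Σ s : {s : Finset X // s.card ≤ k}, (s.1 → X))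
      = ∑ s : {s : Finset X // s.card ≤ k}, Nat.card X ^ s.1.card := by
        simp
    _ ≤ ∑ _s : {s : Finset X // s.card ≤ k}, Nat.card X ^ k :=
        Finset.sum_le_sum fun s _ => Nat.pow_le_pow_right Nat.card_pos s.2
    _ ≤ 2 ^ Nat.card X * Nat.card X ^ k := by
        rw [Finset.sum_const, smul_eq_mul, Finset.card_univ]
        gcongr
        exact (Fintype.card_subtype_le _).trans_eq (by simp)

theorem card_monoidHom_perm_le [Finite V] [Finite X] [Nonempty X] :
    Nat.card (V →* Perm X) ≤ 2 ^ Nat.card X *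
      Nat.card X ^ ((Nat.card V - 1) * Nat.card X / Nat.card V) *
      (Nat.card V ^ Nat.card X * (Nat.card V ^ Nat.card X) ^ Nat.card V) := by
  choose r g hrg using exists_isOrbitCoding (V := V) (X := X)
  have hinj : Function.Injective fun f => ((⟨r f, (hrg f).card_moved_le⟩ :
      {r : X → X // Nat.card {x // r x ≠ x} ≤ (Nat.card V - 1) * Nat.card X / Nat.card V}),
      g f, fun v x => g f (f v x)) := by
    intro f f' h
    have hr : r f = r f' := congrArg (fun p => p.1.1) h
    have hg : g f = g f' := congrArg (fun p => p.2.1) h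
    have hfg : (fun v x => g f (f v x)) = fun v x => g f' (f' v x) := congrArg (fun p => p.2.2) h
    exact (hrg f).monoidHom_ext (hr ▸ hg ▸ hrg f') fun v x =>
      (congrFun₂ hfg v x).trans (by rw [hg])
  refine (Nat.card_le_card_of_injective _ hinj).trans ?_
  rw [Nat.card_prod, Nat.card_prod, Nat.card_fun, Nat.card_fun, Nat.card_fun]
  gcongr
  exact card_functions_moving_le _

theorem card_monoidHom_semidirectProduct_le {N G : Type*} [Group N] [Group G] [Finite V] [Finite N]
    [Finite G] {ρ : G →* MulAut N} :
    Nat.card (V →* N ⋊[ρ] G) ≤ Nat.card N ^ Nat.card V * Nat.card (V →* G) := by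
  rw [← Nat.card_fun, ← Nat.card_prod]
  refine Nat.card_le_card_of_injective (fun f => (fun v => (f v).left, rightHom.comp f))
    fun f f' h => MonoidHom.ext fun v => SemidirectProduct.ext ?_ ?_
  · exact congrFun (congrArg Prod.fst h) v
  · exact DFunLike.congr_fun (congrArg Prod.snd h) v

theorem card_monoidHom_permWreath_le {M : Type*} [Group M] [Finite M] [Finite V] [Finite X]
    [Nonempty X] :
    Nat.card (V →* PermWreath M X) ≤
      (2 * Nat.card V * (Nat.card M * Nat.card V) ^ Nat.card V) ^ Nat.card X *
        Nat.card X ^ ((Nat.card V - 1) * Nat.card X / Nat.card V) := by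
  refine card_monoidHom_semidirectProduct_le.trans
    ((Nat.mul_le_mul_left _ card_monoidHom_perm_le).trans_eq ?_)
  rw [Nat.card_fun, mul_pow, mul_pow, pow_right_comm, mul_pow, mul_pow]
  ring

end OrbitCoding

section Tail

theorem pow_mul_pow_div_factorial_pow_le {K : ℝ} (hK : 0 ≤ K) (k : ℕ) {n : ℕ} (hn : 0 < n) :
    (K ^ n * (n : ℝ) ^ (k * n / (k + 1)) / n !) ^ (k + 1) ≤
      (K ^ (k + 1) * Real.exp 1 ^ k) ^ n / n ! := by
  have hpow : ((n : ℝ) ^ (k * n / (k + 1))) ^ (k + 1) ≤ ((n : ℝ) ^ n) ^ k := by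
    rw [← pow_mul, ← pow_mul, mul_comm n k]
    exact pow_le_pow_right₀ (by exact_mod_cast hn) (Nat.div_mul_le_self _ _)
  have hexp : (n : ℝ) ^ n ≤ Real.exp 1 ^ n * n ! := by
    have := Real.pow_div_factorial_le_exp (n : ℝ) n.cast_nonneg n
    rwa [div_le_iff₀ (by positivity), ← Real.exp_one_pow] at this
  calc (K ^ n * (n : ℝ) ^ (k * n / (k + 1)) / n !) ^ (k + 1)
      = (K ^ n) ^ (k + 1) * ((n : ℝ) ^ (k * n / (k + 1))) ^ (k + 1) / (n ! : ℝ) ^ (k + 1) := by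
        rw [div_pow, mul_pow]
    _ ≤ (K ^ n) ^ (k + 1) * (Real.exp 1 ^ n * n !) ^ k / (n ! : ℝ) ^ (k + 1) := by
        gcongr
        exact hpow.trans (by gcongr)
    _ = (K ^ (k + 1) * Real.exp 1 ^ k) ^ n / n ! := by
        rw [mul_pow, mul_pow, pow_right_comm K,
          pow_right_comm (Real.exp 1), pow_succ (n ! : ℝ)]
        field_simp

theorem tendsto_pow_mul_pow_div_factorial {K : ℝ} (hK : 0 ≤ K) (k : ℕ) :
    Tendsto (fun n : ℕ => K ^ n * (n : ℝ) ^ (k * n / (k + 1)) / n !) atTop (𝓝 0) := by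
  have hpow : Tendsto (fun n : ℕ => (K ^ n * (n : ℝ) ^ (k * n / (k + 1)) / n !) ^ (k + 1))
      atTop (𝓝 0) :=
    squeeze_zero' (.of_forall fun n => by positivity)
      ((eventually_gt_atTop 0).mono fun n hn => pow_mul_pow_div_factorial_pow_le hK k hn)
      (FloorSemiring.tendsto_pow_div_factorial_atTop _)
  have hroot := hpow.rpow_const (p := ((k + 1 : ℕ) : ℝ)⁻¹) (Or.inr (by positivity))
  rw [Real.zero_rpow (by positivity)] at hroot
  exact hroot.congr fun n => Real.pow_rpow_inv_natCast (by positivity) k.succ_ne_zero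

end Tail

section ImageCard

/-- The law of the order of the image of a uniformly random endomorphism of `H`. -/
noncomputable def imageCardLaw (H : Type*) [Group H] [Finite (Monoid.End H)] : PMF ℕ :=
  letI := Fintype.ofFinite (Monoid.End H)
  (PMF.uniformOfFintype (Monoid.End H)).map fun f : Monoid.End H => Nat.card (MonoidHom.range f)

theorem toOuterMeasure_imageCardLaw_apply (H : Type*) [Group H] [Finite (Monoid.End H)]
    (s : Set ℕ) :
    (imageCardLaw H).toOuterMeasure s = ENNReal.ofReal
      (Nat.card {f : Monoid.End H // Nat.card (MonoidHom.range f) ∈ s} /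
        Nat.card (Monoid.End H)) := by
  classical
  have hpos : (0 : ℝ) < Nat.card (Monoid.End H) := Nat.cast_pos.mpr Nat.card_pos
  let := Fintype.ofFinite (Monoid.End H)
  rw [imageCardLaw, PMF.toOuterMeasure_map_apply, PMF.toOuterMeasure_uniformOfFintype_apply,
    ENNReal.ofReal_div_of_pos hpos, ENNReal.ofReal_natCast, ENNReal.ofReal_natCast,
    Nat.card_eq_fintype_card, Nat.card_eq_fintype_card]
  rfl

end ImageCard

section Endomorphisms

variable (M : Type*) [CommGroup M] [Finite M]

/-- The number of endomorphisms of `PermWreath M (Fin n)` whose quotient part is injective. -/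
noncomputable def numEndInjQuotient (n : ℕ) : ℕ :=
  Nat.card {f : PermWreath M (Fin n) →* PermWreath M (Fin n) // Function.Injective (quotientPart f)}

theorem numEndInjQuotient_eq {n : ℕ} (hn : 7 ≤ n) :
    (numEndInjQuotient M n : ℝ) =
      Nat.card (M →* M) ^ 2 * Nat.card (ℤˣ →* M) * Nat.card M ^ n * n ! / Nat.card M := by
  rw [eq_div_iff (Nat.cast_ne_zero.mpr Nat.card_pos.ne')]
  have := card_injective_quotientPart_mul (M := M) (X := Fin n) (by simpa using hn)
  rw [Fintype.card_fin] at this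
  exact_mod_cast this

theorem isLittleO_card_not_injective_quotientPart :
    (fun n : ℕ => (Nat.card {f : PermWreath M (Fin n) →* PermWreath M (Fin n) //
        ¬ Function.Injective (quotientPart f)} : ℝ)) =o[atTop] fun n => (n ! : ℝ) := by
  obtain ⟨k, hk⟩ : ∃ k, Nat.card (M × ℤˣ) = k + 1 :=
    Nat.exists_eq_succ_of_ne_zero Nat.card_pos.ne'
  refine isLittleO_of_tendsto (fun n h => absurd h (by positivity)) ?_
  refine squeeze_zero' (.of_forall fun n => by positivity) ?_ (tendsto_pow_mul_pow_div_factorial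
    (K := (2 * (k + 1) * (Nat.card M * (k + 1)) ^ (k + 1))) (by positivity) k)
  filter_upwards [eventually_ge_atTop 5] with n hn
  have : Nonempty (Fin n) := ⟨0, by lia⟩
  have hle := (card_not_injective_quotientPart_le (M := M) (X := Fin n) (by simpa using hn)).trans
    card_monoidHom_permWreath_le
  rw [hk, Nat.card_eq_fintype_card (α := Fin n), Fintype.card_fin, Nat.add_sub_cancel] at hle
  gcongr
  exact_mod_cast hle

theorem isBigO_factorial_numEndInjQuotient :
    (fun n : ℕ => (n ! : ℝ)) =O[atTop] fun n => (numEndInjQuotient M n : ℝ) := by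
  refine .of_bound (Nat.card M) ?_
  filter_upwards [eventually_ge_atTop 7] with n hn
  have hM : (0 : ℝ) < Nat.card M := Nat.cast_pos.mpr Nat.card_pos
  rw [Real.norm_natCast, Real.norm_natCast, numEndInjQuotient_eq M hn, mul_div_cancel₀ _ hM.ne']
  have hpos : 0 < Nat.card (M →* M) ^ 2 * Nat.card (ℤˣ →* M) * Nat.card M ^ n :=
    mul_pos (mul_pos (pow_pos Nat.card_pos 2) Nat.card_pos) (pow_pos Nat.card_pos n)
  exact_mod_cast Nat.le_mul_of_pos_left _ hpos

theorem isEquivalent_card_monoidEnd :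
    (fun n : ℕ => (Nat.card (Monoid.End (PermWreath M (Fin n))) : ℝ)) ~[atTop]
      fun n => (numEndInjQuotient M n : ℝ) := by
  have hsum (n : ℕ) : (Nat.card (Monoid.End (PermWreath M (Fin n))) : ℝ) = numEndInjQuotient M n +
      Nat.card {f : PermWreath M (Fin n) →* PermWreath M (Fin n) //
        ¬ Function.Injective (quotientPart f)} := by
    classical
    rw [numEndInjQuotient, ← Nat.cast_add, ← Nat.card_sum]
    exact congrArg _ (Nat.card_congr (Equiv.sumCompl _).symm)
  simp only [hsum]
  exact IsEquivalent.refl.add_isLittleO ((isLittleO_card_not_injective_quotientPart M).trans_isBigO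
    (isBigO_factorial_numEndInjQuotient M))

theorem numEndInjQuotient_le_card_imageCard_mem_Icc (n : ℕ) :
    numEndInjQuotient M n ≤ Nat.card {f : Monoid.End (PermWreath M (Fin n)) //
      Nat.card (MonoidHom.range f) ∈ Set.Icc (n !) (Nat.card M ^ n * n !)} := by
  have hcard : Nat.card (PermWreath M (Fin n)) = Nat.card M ^ n * n ! := by
    rw [PermWreath.card, Fintype.card_fin]
  refine Nat.card_le_card_of_injective (fun f => ⟨f.1, ?_, ?_⟩)
    fun _ _ h => Subtype.ext (congrArg (fun f => f.1) h)
  · have := card_le_card_range_of_injective_quotientPart f.2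
    rwa [Nat.card_perm, Nat.card_eq_fintype_card, Fintype.card_fin] at this
  · rw [← hcard]
    exact Nat.card_le_card_of_injective _ Subtype.val_injective

theorem tendsto_imageCardLaw :
    Tendsto (fun n : ℕ => (imageCardLaw (PermWreath M (Fin n))).toOuterMeasure
      (Set.Icc (n !) (Nat.card M ^ n * n !))) atTop (𝓝 1) := by
  simp only [toOuterMeasure_imageCardLaw_apply]
  rw [← ENNReal.ofReal_one]
  have hpos (n : ℕ) : (0 : ℝ) < Nat.card (Monoid.End (PermWreath M (Fin n))) :=
    Nat.cast_pos.mpr Nat.card_pos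
  have hlim := (isEquivalent_iff_tendsto_one (.of_forall fun n => (hpos n).ne')).mp
    (isEquivalent_card_monoidEnd M).symm
  refine ENNReal.tendsto_ofReal (tendsto_of_tendsto_of_tendsto_of_le_of_le hlim
    tendsto_const_nhds (fun n => ?_) fun n => ?_)
  · exact div_le_div_of_nonneg_right
      (Nat.cast_le.mpr (numEndInjQuotient_le_card_imageCard_mem_Icc M n)) (hpos n).le
  · exact (div_le_one (hpos n)).mpr
      (Nat.cast_le.mpr (Nat.card_le_card_of_injective _ Subtype.val_injective))

end Endomorphisms

theorem mainTheorem6_general (M : Type*) [CommGroup M] [Finite M] :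
    (∀ n : ℕ, Nat.card (PermWreath M (Fin n)) = Nat.card M ^ n * n !) ∧
    Tendsto (fun n : ℕ => (imageCardLaw (PermWreath M (Fin n))).toOuterMeasure
      (Set.Icc (n !) (Nat.card M ^ n * n !))) atTop (𝓝 1) ∧
    (fun n : ℕ => (Nat.card (Monoid.End (PermWreath M (Fin n))) : ℝ)) ~[atTop] fun n : ℕ =>
      (Nat.card (M →* M) : ℝ) ^ 2 * Nat.card (ℤˣ →* M) * Nat.card M ^ n * n ! / Nat.card M := by
  refine ⟨fun n => ?_, tendsto_imageCardLaw M, ?_⟩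
  · rw [PermWreath.card, Fintype.card_fin]
  · exact (isEquivalent_card_monoidEnd M).congr_right
      ((eventually_ge_atTop 7).mono fun n hn => numEndInjQuotient_eq M hn)

theorem card_intUnits : Nat.card ℤˣ = 2 := by
  rw [Nat.card_eq_fintype_card, Fintype.card_units_int]

theorem card_intUnits_monoidHom : Nat.card (ℤˣ →* ℤˣ) = 2 := by
  have : HasEnoughRootsOfUnity ℤ (Nat.card ℤˣ) := by
    rw [card_intUnits]
    exact ⟨⟨-1, .neg_one 0 (by decide)⟩, inferInstance⟩
  rw [Nat.card_congr (IsCyclic.monoidHom_equiv_self ℤˣ ℤ).some.toEquiv, card_intUnits]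

theorem mainTheorem6 :
    (∀ n : ℕ, Nat.card (SignedPerm n) = 2 ^ n * n !) ∧
    Tendsto (fun n : ℕ => (imageOrderLaw n).toOuterMeasure (Set.Icc (n !) (2 ^ n * n !)))
      atTop (𝓝 1) ∧
    (fun n : ℕ => (numEnd n : ℝ)) ~[atTop] (fun n : ℕ => (2 : ℝ) ^ (n + 2) * (n ! : ℝ)) := by
  obtain ⟨hcard, hlaw, hequiv⟩ := mainTheorem6_general ℤˣ
  simp only [card_intUnits_monoidHom, card_intUnits] at hcard hlaw hequiv
  refine ⟨hcard, hlaw, hequiv.congr_right (.of_forall fun n => ?_)⟩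
  push_cast
  ring
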